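/- Let $\Sigma$ be a finite alphabet and let $\mathrm{RegE}(\Sigma)$ be the set of expressions generated by $e,f ::= a\in\Sigma \mid 0 \mid e\sqcup f \mid \top \mid e\sqcap f \mid 1 \mid e\star f \mid e^\diamond$. **Transitions and polarities.** Let $\to$ be the least relation on expressions with $e\sqcup f\to e$, $e\sqcup f\to f$, $e\sqcap f\to e$, $e\sqcap f\to f$, $a\to 1$ for $a\in\Sigma$, $e\star 1\to e$, $e^\diamond\to 1$, $e^\diamond\to e^\diamond\star e$, and $g\star e\to g\star f$ whenever $e\to f$. The polarity of an expression is defined by $\mathrm{pol}(e\star f)=\mathrm{pol}(f)$, $\mathrm{pol}(a)={?}_a$ for $a\in\Sigma$, $\mathrm{pol}(e)=\exists$ if $e$ is $0$, $1$, $e_1\sqcup e_2$ or $e_1^\diamond$, and $\mathrm{pol}(e)=\forall$ if $e$ is $\top$ or $e_1\sqcap e_2$. **The game $\mathcal G_\bullet$.** Positions are pairs $X\dashv e$ with $X$ a finite set of expressions and $e$ an expression. Call $X$ *resolved* if every $t\in X\setminus\{1\}$ has polarity ${?}_a$ for some $a\in\Sigma$. A position $X\dashv e$ belongs to Spoiler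 if $X$ is not resolved, or if $e=1$ and $1\in X$, or if $\mathrm{pol}(e)=\forall$; all other positions belong to Duplicator. The moves from $X\dashv e$ are: - *explore*: to $(X\setminus\{t\})\cup\{t'\}\dashv e$, when $t\in X$, $\mathrm{pol}(t)=\exists$ and $t\to t'$; - *fork*: to $(X\setminus\{t\})\cup\{t'\mid t\to t'\}\dashv e$, when $t\in X$ and $\mathrm{pol}(t)=\forall$; - *alea*: to $X\dashv e'$, when $\mathrm{pol}(e)=\forall$, $X$ is resolved and $e\to e'$; - *choose*: to $X\dashv e'$, when the position belongs to Duplicator, $\mathrm{pol}(e)=\exists$ and $e\to e'$; - *junk*: to $X\dashv e'$, when the position belongs to Duplicator, $\mathrm{pol}(e)={?}_a$ for some $a\in\Sigma$ and $e\to e'$; - *fill*: to $(X\setminus\{t\})\cup\{t'\}\dashv e'$, when the position belongs to Duplicator, $t\in X$, $\mathrm{pol}(e)=\mathrm{pol}(t)={?}_a$ for some $a\in\Sigma$, $e\to e'$ and $t\to t'$. The winning positions are those that belong to Spoiler and from which no alea move can be played. Duplicator wins a finite play that cannot be extended iff its last position is winning, and wins an infinite play iff it visits winning positions infinitely often. Duplicator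 wins $\mathcal G_\bullet(X\dashv e)$ if Duplicator has a winning strategy from $X\dashv e$. **The theory $\mathrm{pSRKA}$.** Its terms are the expressions without $0,\top,\sqcap$, and its axioms and rules are, for all such terms (with $a=b$ standing for $a\le b$ and $b\le a$): - $a\le b \wedge b\le c\Rightarrow a\le c$; $\;a\le a\sqcup b$; $\;b\le a\sqcup b$; $\;b\le a\wedge c\le a\Rightarrow b\sqcup c\le a$; - $a\star 1=a=1\star a$; $\;a\star(b\star c)=(a\star b)\star c$; $\;a\le a'\wedge b\le b'\Rightarrow a\star b\le a'\star b'$; $\;a\star(b\sqcup c)\le(a\star b)\sqcup(a\star c)$; - $1\le a^\diamond$; $\;a^\diamond\star a\le a^\diamond$; $\;a\star b\le a\Rightarrow a\star b^\diamond\le a$; - $1\le a$. **Theorem.** Let $e,f\in\mathrm{RegE}(\Sigma)$ contain none of $0$, $\top$, $\sqcap$. If Duplicator wins $\mathcal G_\bullet(\{e\}\dashv f)$, then $e\le f$ is derivable in $\mathrm{pSRKA}$. -/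

import Mathlib

namespace WeihrauchTheory

/-- Expressions over the alphabet `α`: letters, `0`, `⊤`, `1`, join `⊔`, meet `⊓`,
composition `⋆` and iterated composition `(-)^⋄`. -/
inductive RegE (α : Type*) where
  | letter (a : α)
  | zero
  | join (e f : RegE α)
  | top
  | meet (e f : RegE α)
  | one
  | comp (e f : RegE α)
  | iter (e : RegE α)

/-- Polarity of an expression: `∃`, `∀`, or `?_a` for a letter `a`. -/
inductive Polarity (α : Type*) where
  | ex
  | all
  | oracle (a : α)

namespace RegE

variable {α : Type*}

/-- The expression contains none of `0`, `⊤`, `⊓`. -/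
def InFragment : RegE α → Prop
  | letter _ => True
  | zero => False
  | join e f => e.InFragment ∧ f.InFragment
  | top => False
  | meet _ _ => False
  | one => True
  | comp e f => e.InFragment ∧ f.InFragment
  | iter e => e.InFragment

/-- The polarity of an expression; a composition is run from right to left. -/
def pol : RegE α → Polarity α
  | letter a => .oracle a
  | zero => .ex
  | join _ _ => .ex
  | top => .all
  | meet _ _ => .all
  | one => .ex
  | comp _ f => f.pol
  | iter _ => .ex

/-- The transition relation `e → f` on expressions. -/
inductive Step : RegE α → RegE α → Prop
  | join_left (e f : RegE α) : Step (join e f) e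
  | join_right (e f : RegE α) : Step (join e f) f
  | meet_left (e f : RegE α) : Step (meet e f) e
  | meet_right (e f : RegE α) : Step (meet e f) f
  | letter (a : α) : Step (letter a) one
  | comp_one (e : RegE α) : Step (comp e one) e
  | iter_one (e : RegE α) : Step (iter e) one
  | iter_unfold (e : RegE α) : Step (iter e) (comp (iter e) e)
  | comp (g : RegE α) {e f : RegE α} : Step e f → Step (comp g e) (comp g f)

/-- `DerivablePSRKA e f`: the inequation `e ≤ f` is derivable in the theory pSRKA, whose terms are
the expressions without `0`, `⊤`, `⊓`. An equational axiom is given as two inequations;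
reflexivity follows from the unit axioms and transitivity. -/
inductive DerivablePSRKA : RegE α → RegE α → Prop
  | trans {a b c : RegE α} :
      DerivablePSRKA a b → DerivablePSRKA b c → DerivablePSRKA a c
  | le_join_left {a b : RegE α} (ha : a.InFragment) (hb : b.InFragment) :
      DerivablePSRKA a (join a b)
  | le_join_right {a b : RegE α} (ha : a.InFragment) (hb : b.InFragment) :
      DerivablePSRKA b (join a b)
  | join_le {a b c : RegE α} :
      DerivablePSRKA b a → DerivablePSRKA c a → DerivablePSRKA (join b c) a
  | comp_one_le {a : RegE α} (ha : a.InFragment) : DerivablePSRKA (comp a one) a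
  | le_comp_one {a : RegE α} (ha : a.InFragment) : DerivablePSRKA a (comp a one)
  | one_comp_le {a : RegE α} (ha : a.InFragment) : DerivablePSRKA (comp one a) a
  | le_one_comp {a : RegE α} (ha : a.InFragment) : DerivablePSRKA a (comp one a)
  | assoc_le {a b c : RegE α}
      (ha : a.InFragment) (hb : b.InFragment) (hc : c.InFragment) :
      DerivablePSRKA (comp a (comp b c)) (comp (comp a b) c)
  | le_assoc {a b c : RegE α}
      (ha : a.InFragment) (hb : b.InFragment) (hc : c.InFragment) :
      DerivablePSRKA (comp (comp a b) c) (comp a (comp b c))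
  | comp_mono {a a' b b' : RegE α} :
      DerivablePSRKA a a' → DerivablePSRKA b b' → DerivablePSRKA (comp a b) (comp a' b')
  | comp_join_le {a b c : RegE α}
      (ha : a.InFragment) (hb : b.InFragment) (hc : c.InFragment) :
      DerivablePSRKA (comp a (join b c)) (join (comp a b) (comp a c))
  | one_le_iter {a : RegE α} (ha : a.InFragment) : DerivablePSRKA one (iter a)
  | iter_comp_le {a : RegE α} (ha : a.InFragment) : DerivablePSRKA (comp (iter a) a) (iter a)
  | iter_induction {a b : RegE α} :
      DerivablePSRKA (comp a b) a → DerivablePSRKA (comp a (iter b)) a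
  | one_le {a : RegE α} (ha : a.InFragment) : DerivablePSRKA one a

end RegE

/-- The two players; Duplicator owns the positions of polarity `∃`, Spoiler those of
polarity `∀`. -/
inductive Player where
  | duplicator
  | spoiler

/-- A Büchi arena with set of positions `V`. -/
structure BuchiArena (V : Type*) where
  /-- moves -/
  Move : V → V → Prop
  /-- the player who moves at a position -/
  owner : V → Player
  /-- winning positions for Duplicator -/
  winning : Set V

namespace BuchiArena

variable {V : Type*}

/-- A strategy for Duplicator from `v`, given by the set `s` of its finite partial plays (non-empty
lists of positions, in order). An infinite play belongs to the strategy iff all its finite prefixes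
do, so the finite partial plays determine it. -/
structure IsDuplicatorStrategy (A : BuchiArena V) (v : V) (s : Set (List V)) : Prop where
  nonempty : s.Nonempty
  starts : ∀ p ∈ s, p.head? = some v
  isPlay : ∀ p ∈ s, p.IsChain A.Move
  prefix_closed : ∀ p ∈ s, ∀ q, q ≠ [] → q <+: p → q ∈ s
  spoiler_move : ∀ p x, p ++ [x] ∈ s → A.owner x = .spoiler →
    ∀ m, A.Move x m → p ++ [x] ++ [m] ∈ s
  duplicator_move : ∀ p x, p ++ [x] ∈ s → A.owner x = .duplicator →
    ∃! m, A.Move x m ∧ p ++ [x] ++ [m] ∈ s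

/-- A strategy is winning if each of its finite plays that cannot be extended ends in a winning
position, and each of its infinite plays visits winning positions infinitely often. -/
structure IsWinning (A : BuchiArena V) (s : Set (List V)) : Prop where
  finite_play : ∀ p x, p ++ [x] ∈ s → (∀ m, ¬ A.Move x m) → x ∈ A.winning
  infinite_play : ∀ π : ℕ → V, (∀ n, (List.range (n + 1)).map π ∈ s) →
    {i | π i ∈ A.winning}.Infinite

/-- Duplicator has a winning strategy in the game on `A` from `v`. -/
def DuplicatorWins (A : BuchiArena V) (v : V) : Prop :=
  ∃ s : Set (List V), A.IsDuplicatorStrategy v s ∧ A.IsWinning s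

end BuchiArena

/-- Positions `Γ | X ⊣ e` of the simulation game. -/
structure SimPos (α : Type*) where
  seen : Set α
  left : Finset (RegE α)
  right : RegE α

namespace SimPos

variable {α : Type*}

/-- `X` is resolved: every member other than `1` has an oracle polarity. -/
def Resolved (X : Finset (RegE α)) : Prop :=
  ∀ t ∈ X, t ≠ .one → ∃ a, t.pol = .oracle a

open Classical in
/-- The player who moves at a position. A completed simulation, with `e = 1` and `1 ∈ X`, belongs to
Spoiler; this makes such a position winning for Duplicator when it has no moves. -/
noncomputable def owner (p : SimPos α) : Player :=
  if ¬ Resolved p.left then .spoiler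
  else if p.right = .one ∧ .one ∈ p.left then .spoiler
  else match p.right.pol with
    | .all => .spoiler
    | .ex => .duplicator
    | .oracle _ => .duplicator

/-- The kinds of moves of the simulation game. -/
inductive MoveKind where
  | explore
  | fork
  | alea
  | choose
  | junk
  | fill

open RegE in
/-- The moves of the simulation game, by kind. -/
inductive Move : MoveKind → SimPos α → SimPos α → Prop
  | explore {Γ : Set α} {X X' : Finset (RegE α)} {e t t' : RegE α}
      (ht : t ∈ X) (hpol : t.pol = .ex) (hstep : Step t t')
      (hX' : (X' : Set (RegE α)) = ((X : Set (RegE α)) \ {t}) ∪ {t'}) :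
      Move .explore ⟨Γ, X, e⟩ ⟨Γ, X', e⟩
  | fork {Γ : Set α} {X X' : Finset (RegE α)} {e t : RegE α}
      (ht : t ∈ X) (hpol : t.pol = .all)
      (hX' : (X' : Set (RegE α)) = ((X : Set (RegE α)) \ {t}) ∪ {t' | Step t t'}) :
      Move .fork ⟨Γ, X, e⟩ ⟨Γ, X', e⟩
  | alea {Γ : Set α} {X : Finset (RegE α)} {e e' : RegE α}
      (hpol : e.pol = .all) (hX : Resolved X) (hstep : Step e e') :
      Move .alea ⟨Γ, X, e⟩ ⟨Γ, X, e'⟩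
  | choose {Γ : Set α} {X : Finset (RegE α)} {e e' : RegE α}
      (hpol : e.pol = .ex) (howner : owner ⟨Γ, X, e⟩ = .duplicator) (hstep : Step e e') :
      Move .choose ⟨Γ, X, e⟩ ⟨Γ, X, e'⟩
  | junk {Γ : Set α} {X : Finset (RegE α)} {e e' : RegE α} {a : α}
      (howner : owner ⟨Γ, X, e⟩ = .duplicator) (hpol : e.pol = .oracle a) (ha : a ∈ Γ)
      (hstep : Step e e') :
      Move .junk ⟨Γ, X, e⟩ ⟨Γ, X, e'⟩
  | fill {Γ : Set α} {X X' : Finset (RegE α)} {e e' t t' : RegE α} {a : α}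
      (howner : owner ⟨Γ, X, e⟩ = .duplicator) (ht : t ∈ X)
      (hpole : e.pol = .oracle a) (hpolt : t.pol = .oracle a)
      (hstep : Step e e') (hstept : Step t t')
      (hX' : (X' : Set (RegE α)) = ((X : Set (RegE α)) \ {t}) ∪ {t'}) :
      Move .fill ⟨Γ, X, e⟩ ⟨Γ ∪ {a}, X', e'⟩

end SimPos

/-- The simulation arena. The winning positions are Spoiler's positions where no alea move can be
played. -/
noncomputable def simGame (α : Type*) : BuchiArena (SimPos α) where
  Move p q := ∃ k, SimPos.Move k p q
  owner := SimPos.owner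
  winning := {p | p.owner = .spoiler ∧ ¬ ∃ q, SimPos.Move .alea p q}

/-- Positions `X ⊣ e` of the pointed simulation game. -/
structure PSimPos (α : Type*) where
  left : Finset (RegE α)
  right : RegE α

/-- The position of the simulation game, with the full alphabet as first component, that underlies a
position of the pointed game. -/
def PSimPos.toSimPos {α : Type*} (p : PSimPos α) : SimPos α := ⟨Set.univ, p.left, p.right⟩

/-- The pointed simulation arena. -/
noncomputable def psimGame (α : Type*) : BuchiArena (PSimPos α) where
  Move p q := (simGame α).Move p.toSimPos q.toSimPos
  owner p := (simGame α).owner p.toSimPos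
  winning := {p | p.toSimPos ∈ (simGame α).winning}

end WeihrauchTheory

namespace WeihrauchTheory

open Relation

/-! ### Transitions and the order of pSRKA -/

namespace RegE

variable {α : Type*}

/-! Without `⊓` and `⊤` no fork is possible, so a left side `{t}` stays a singleton, and the pairs
`(t, f)` won by Duplicator form a simulation: Spoiler makes the `∃`-steps of `t`, and at a
`?_a`-step of `t` Duplicator cannot stall forever in non-winning positions, hence must play a fill
(`isSimulation_duplicatorWins`). Since `1 ≤ a`, targets of transitions lie below their sources, so
the moves Duplicator makes on the right before a fill cost nothing.

A simulation of `e` by `f` yields a derivation by induction on `e` (`IsSimulation.comp_derivable`),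
with an accumulator `k` for what remains to run after `e`. For `e^⋄`, finiteness of the reachable
set gives a recurrent `g` below `f` that still simulates `e^⋄`. A run of `e` from `g` ends at
expressions from which `g` is reachable, hence above `g`. So `g ⋆ e ≤ g`, and the induction rule
gives `g ⋆ e^⋄ ≤ g`. -/

lemma DerivablePSRKA.refl {e : RegE α} (he : e.InFragment) : DerivablePSRKA e e :=
  .trans (.le_comp_one he) (.comp_one_le he)

lemma Step.inFragment {e f : RegE α} (h : Step e f) (he : e.InFragment) : f.InFragment := by
  induction h with
  | join_left | comp_one => exact he.1
  | join_right => exact he.2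
  | meet_left | meet_right => exact he.elim
  | letter | iter_one => trivial
  | iter_unfold => exact ⟨he, he⟩
  | comp g _ ih => exact ⟨he.1, ih he.2⟩

/-- In the pointed theory expressions decrease along transitions. -/
lemma Step.derivable {e f : RegE α} (h : Step e f) (he : e.InFragment) : DerivablePSRKA f e := by
  induction h with
  | join_left => exact .le_join_left he.1 he.2
  | join_right => exact .le_join_right he.1 he.2
  | meet_left | meet_right => exact he.elim
  | letter a => exact .one_le he
  | comp_one => exact .le_comp_one he.1
  | iter_one => exact .one_le_iter he
  | iter_unfold => exact .iter_comp_le he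
  | comp g _ ih => exact .comp_mono (.refl he.1) (ih he.2)

lemma inFragment_of_reflTransGen {e f : RegE α} (h : ReflTransGen Step e f)
    (he : e.InFragment) : f.InFragment := by
  induction h with
  | refl => exact he
  | tail _ hs ih => exact hs.inFragment ih

lemma derivable_of_reflTransGen {e f : RegE α} (h : ReflTransGen Step e f)
    (he : e.InFragment) : DerivablePSRKA f e := by
  induction h with
  | refl => exact .refl he
  | tail hr hs ih => exact .trans (hs.derivable (inFragment_of_reflTransGen hr he)) ih

/-- A transition of polarity `?_a` peels off a letter `a`. -/
lemma Step.comp_letter_derivable {e f : RegE α} {a : α} (h : Step e f) (hpol : e.pol = .oracle a)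
    (he : e.InFragment) : DerivablePSRKA (f.comp (.letter a)) e := by
  induction h with
  | join_left | join_right | meet_left | meet_right | iter_one | iter_unfold | comp_one =>
    simp [pol] at hpol
  | letter b =>
    simp only [pol, Polarity.oracle.injEq] at hpol
    subst hpol
    exact .one_comp_le he
  | comp g hs ih =>
    exact .trans (.le_assoc he.1 (hs.inFragment he.2) trivial)
      (.comp_mono (.refl he.1) (ih hpol he.2))

/-- Duplicator picks the left successor in a fill, whereas a simulation must handle every successor;
determinism reconciles the two. -/
lemma Step.unique_of_oracle {e f f' : RegE α} {a : α} (h : Step e f) (h' : Step e f')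
    (hpol : e.pol = .oracle a) : f = f' := by
  induction h generalizing f' with
  | join_left | join_right | meet_left | meet_right | iter_one | iter_unfold | comp_one =>
    simp [pol] at hpol
  | letter b => cases h'; rfl
  | comp g hs ih =>
    cases h' with
    | comp_one => simp [pol] at hpol
    | comp _ hs' => rw [ih hs' hpol]

lemma pol_ne_all {e : RegE α} (he : e.InFragment) : e.pol ≠ .all := by
  induction e with
  | comp e f _ ih => exact ih he.2
  | top | meet => exact he.elim
  | _ => simp [pol]

/-! ### Finiteness of reachability and recurrent expressions -/

lemma setOf_reflTransGen_subset {e : RegE α} {s : Set (RegE α)} (he : e ∈ s)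
    (hs : ∀ x ∈ s, ∀ y, Step x y → y ∈ s) : {f | ReflTransGen Step e f} ⊆ s := by
  intro f hf
  induction hf with
  | refl => exact he
  | tail _ h ih => exact hs _ ih _ h

/-- Only finitely many expressions are reachable from a given one. -/
lemma finite_setOf_reflTransGen (e : RegE α) : {f | ReflTransGen Step e f}.Finite := by
  induction e with
  | letter a =>
    refine (Set.toFinite {letter a, one}).subset (setOf_reflTransGen_subset (by simp) ?_)
    rintro x (rfl | rfl) y h <;> cases h
    simp
  | zero =>
    refine (Set.toFinite {zero}).subset (setOf_reflTransGen_subset (by simp) ?_)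
    rintro x rfl y h
    cases h
  | top =>
    refine (Set.toFinite {top}).subset (setOf_reflTransGen_subset (by simp) ?_)
    rintro x rfl y h
    cases h
  | one =>
    refine (Set.toFinite {one}).subset (setOf_reflTransGen_subset (by simp) ?_)
    rintro x rfl y h
    cases h
  | join e f ihe ihf =>
    refine ((ihe.union ihf).insert (join e f)).subset (setOf_reflTransGen_subset (by simp) ?_)
    rintro x (rfl | hx | hx) y h
    · cases h
      · exact .inr (.inl .refl)
      · exact .inr (.inr .refl)
    · exact .inr (.inl (hx.tail h))
    · exact .inr (.inr (hx.tail h))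
  | meet e f ihe ihf =>
    refine ((ihe.union ihf).insert (meet e f)).subset (setOf_reflTransGen_subset (by simp) ?_)
    rintro x (rfl | hx | hx) y h
    · cases h
      · exact .inr (.inl .refl)
      · exact .inr (.inr .refl)
    · exact .inr (.inl (hx.tail h))
    · exact .inr (.inr (hx.tail h))
  | comp e f ihe ihf =>
    refine ((ihf.image (comp e)).union ihe).subset
      (setOf_reflTransGen_subset (.inl ⟨f, .refl, rfl⟩) ?_)
    rintro x (⟨z, hz, rfl⟩ | hx) y h
    · cases h with
      | comp_one => exact .inr .refl
      | comp _ h => exact .inl ⟨_, ReflTransGen.tail hz h, rfl⟩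
    · exact .inr (hx.tail h)
  | iter e ih =>
    refine (((ih.image (comp (iter e))).insert one).insert (iter e)).subset
      (setOf_reflTransGen_subset (by simp) ?_)
    rintro x (rfl | rfl | ⟨z, hz, rfl⟩) y h
    · cases h
      · exact .inr (.inl rfl)
      · exact .inr (.inr ⟨e, .refl, rfl⟩)
    · cases h
    · cases h with
      | comp_one => exact .inl rfl
      | comp _ h => exact .inr (.inr ⟨_, ReflTransGen.tail hz h, rfl⟩)

/-- Among the expressions reachable from `f` that satisfy a property, some `h` is reachable from
all those that are reachable from `h`. -/
lemma exists_recurrent {P : RegE α → Prop} {f : RegE α} (hf : P f) :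
    ∃ h, ReflTransGen Step f h ∧ P h ∧
      ∀ h', ReflTransGen Step h h' → P h' → ReflTransGen Step h' h := by
  -- Minimise the number of reachable expressions: moving on from `h` within `P` can then lose none
  -- of them, in particular not `h` itself.
  obtain ⟨h, ⟨hfh, hP⟩, hmin⟩ := Set.exists_min_image {h | ReflTransGen Step f h ∧ P h}
    (fun h => {g | ReflTransGen Step h g}.ncard)
    ((finite_setOf_reflTransGen f).subset fun _ hx => hx.1) ⟨f, .refl, hf⟩
  refine ⟨h, hfh, hP, fun h' hr hP' => ?_⟩
  have heq := Set.eq_of_subset_of_ncard_le (fun g (hg : ReflTransGen Step h' g) => hr.trans hg)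
    (hmin h' ⟨hfh.trans hr, hP'⟩) (finite_setOf_reflTransGen h)
  have hmem : h ∈ {g | ReflTransGen Step h g} := .refl
  rwa [← heq] at hmem

/-! ### From simulations to derivations -/

/-- Simulations up to termination: a step of polarity `∃` on the left is matched by no step on the
right, a step of polarity `?_a` by finitely many steps, the last one of polarity `?_a`. -/
structure IsSimulation (R : RegE α → RegE α → Prop) : Prop where
  explore : ∀ {t t' f}, R t f → t.pol = .ex → Step t t' → R t' f
  fill : ∀ {t t' f a}, R t f → t.pol = .oracle a → Step t t' →
    ∃ g f', ReflTransGen Step f g ∧ g.pol = .oracle a ∧ Step g f' ∧ R t' f'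

/-- The right factor of a composition runs first and determines its polarity, so its run can be
studied with `e` as a fixed context. -/
lemma IsSimulation.comp {R : RegE α → RegE α → Prop} (hR : IsSimulation R) (e : RegE α) :
    IsSimulation fun t f => R (e.comp t) f where
  explore h hpol hs := hR.explore h hpol (.comp e hs)
  fill h hpol hs := hR.fill h hpol (.comp e hs)

/-- If `e` is simulated by `f` and `k` lies below all expressions that the simulation relates to the
end of `e`, then `k ⋆ e` lies below `f`. -/
theorem IsSimulation.comp_derivable {e : RegE α} (he : e.InFragment)
    {R : RegE α → RegE α → Prop} (hR : IsSimulation R) {f k : RegE α} (hf : f.InFragment)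
    (hk : k.InFragment) (h : R e f)
    (hend : ∀ f', ReflTransGen Step f f' → R one f' → DerivablePSRKA k f') :
    DerivablePSRKA (k.comp e) f := by
  induction e generalizing R f k with
  | letter a =>
    obtain ⟨g, f', hfg, hpol, hg, hf'⟩ := hR.fill h rfl (.letter a)
    exact .trans (.comp_mono (hend f' (hfg.tail hg) hf') (.refl he))
      (.trans (hg.comp_letter_derivable hpol (inFragment_of_reflTransGen hfg hf))
        (derivable_of_reflTransGen hfg hf))
  | zero | top | meet => exact he.elim
  | join e₁ e₂ ih₁ ih₂ =>
    exact .trans (.comp_join_le hk he.1 he.2) (.join_le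
      (ih₁ he.1 hR hf hk (hR.explore h rfl (.join_left _ _)) hend)
      (ih₂ he.2 hR hf hk (hR.explore h rfl (.join_right _ _)) hend))
  | one => exact .trans (.comp_one_le hk) (hend f .refl h)
  | comp e₁ e₂ ih₁ ih₂ =>
    -- `e₂` runs first, with `k ⋆ e₁` as accumulator; at its end, `e₁ ⋆ 1` steps to `e₁`, which then
    -- runs with accumulator `k`.
    refine .trans (.assoc_le hk he.1 he.2)
      (ih₂ he.2 (hR.comp e₁) hf ⟨hk, he.1⟩ h fun f' hff' h' => ?_)
    exact ih₁ he.1 hR (inFragment_of_reflTransGen hff' hf) hk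
      (hR.explore h' rfl (.comp_one e₁)) fun f'' hr => hend f'' (hff'.trans hr)
  | iter e ih =>
    obtain ⟨g, hfg, hg, hrec⟩ := exists_recurrent (P := R (iter e)) h
    have hgF := inFragment_of_reflTransGen hfg hf
    -- The accumulator is `g` itself: at the end of `e`, `iter e ⋆ 1` steps back to `iter e`, so
    -- recurrence applies.
    have hge : DerivablePSRKA (g.comp e) g :=
      ih he (hR.comp (iter e)) hgF hgF (hR.explore hg rfl (.iter_unfold e)) fun f' hgf' h' =>
        derivable_of_reflTransGen (hrec f' hgf' (hR.explore h' rfl (.comp_one _)))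
          (inFragment_of_reflTransGen hgf' hgF)
    exact .trans (.comp_mono (hend g hfg (hR.explore hg rfl (.iter_one e))) (.refl he))
      (.trans (.iter_induction hge) (derivable_of_reflTransGen hfg hf))

theorem IsSimulation.derivable {R : RegE α → RegE α → Prop} (hR : IsSimulation R) {e f : RegE α}
    (he : e.InFragment) (hf : f.InFragment) (h : R e f) : DerivablePSRKA e f :=
  .trans (.le_one_comp he) (hR.comp_derivable he hf trivial h fun _ hr _ =>
    .one_le (inFragment_of_reflTransGen hr hf))

end RegE

/-! ### Winning strategies in Büchi arenas -/

namespace BuchiArena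

variable {V : Type*} {A : BuchiArena V} {v : V} {s : Set (List V)}

lemma IsDuplicatorStrategy.start_mem (hs : A.IsDuplicatorStrategy v s) : [v] ∈ s := by
  obtain ⟨p, hp⟩ := hs.nonempty
  have := hs.starts p hp
  cases p with
  | nil => simp at this
  | cons x p =>
    simp only [List.head?_cons, Option.some.injEq] at this
    subst this
    exact hs.prefix_closed _ hp _ (by simp) ⟨p, rfl⟩

/-- Duplicator wins from the last position of each play of a winning strategy. -/
lemma IsDuplicatorStrategy.duplicatorWins (hs : A.IsDuplicatorStrategy v s) (hw : A.IsWinning s)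
    {p : List V} {x : V} (hp : p ++ [x] ∈ s) : A.DuplicatorWins x := by
  have hhead (q : List V) (y m : V) : (q ++ [y] ++ [m]).head? = (q ++ [y]).head? := by
    cases q <;> rfl
  refine ⟨{q | q.head? = some x ∧ p ++ q ∈ s}, ⟨⟨[x], rfl, hp⟩, fun q hq => hq.1, ?_, ?_, ?_, ?_⟩,
    ⟨?_, ?_⟩⟩
  · exact fun q hq => (hs.isPlay _ hq.2).right_of_append
  · rintro q hq r hr ⟨u, rfl⟩
    refine ⟨?_, hs.prefix_closed _ hq.2 _ (by simp [hr]) ⟨u, by simp⟩⟩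
    have := hq.1
    cases r with
    | nil => exact absurd rfl hr
    | cons => simpa using this
  · rintro q y ⟨hq, hqs⟩ hy m hm
    refine ⟨(hhead q y m).trans hq, ?_⟩
    simpa using hs.spoiler_move (p ++ q) y (by simpa using hqs) hy m hm
  · rintro q y ⟨hq, hqs⟩ hy
    obtain ⟨m, ⟨hm, hms⟩, huniq⟩ := hs.duplicator_move (p ++ q) y (by simpa using hqs) hy
    refine ⟨m, ⟨hm, (hhead q y m).trans hq, by simpa using hms⟩, ?_⟩
    rintro m' ⟨hm', -, hms'⟩
    exact huniq m' ⟨hm', by simpa using hms'⟩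
  · rintro q y ⟨-, hqs⟩ hy
    exact hw.finite_play (p ++ q) y (by simpa using hqs) hy
  · intro π hπ
    -- The infinite play `p` followed by `π`; the default value of `getD` takes over past the end of
    -- `p`.
    let π' : ℕ → V := fun i => p.getD i (π (i - p.length))
    have hπ' (i : ℕ) : π' (p.length + i) = π i := by simp [π']
    have hmap (n : ℕ) : (List.range (p.length + n)).map π' = p ++ (List.range n).map π := by
      rw [List.range_add, List.map_append, List.map_map]
      congr 1
      · refine List.ext_getElem (by simp) fun i h₁ h₂ => ?_
        simp [π', h₂]
      · exact List.map_congr_left fun i _ => hπ' i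
    have hinf := hw.infinite_play π' fun n => by
      refine hs.prefix_closed _ (hπ n).2 _ (by simp) ?_
      rw [← hmap, show p.length + (n + 1) = (n + 1) + p.length by omega, List.range_add (n := n + 1),
        List.map_append]
      exact ⟨_, rfl⟩
    refine fun hfin => hinf (((Set.finite_Iio p.length).union
      (hfin.image (p.length + ·))).subset fun i hi => ?_)
    rcases lt_or_ge i p.length with hlt | hge
    · exact .inl hlt
    · refine .inr ⟨i - p.length, ?_, by simp; omega⟩
      have := hπ' (i - p.length)
      rw [Nat.add_sub_cancel' hge] at this
      exact show π (i - p.length) ∈ A.winning by rw [← this]; exact hi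

lemma DuplicatorWins.of_spoiler_move (h : A.DuplicatorWins v) {m : V} (hv : A.owner v = .spoiler)
    (hm : A.Move v m) : A.DuplicatorWins m := by
  obtain ⟨s, hs, hw⟩ := h
  exact hs.duplicatorWins hw (hs.spoiler_move [] v hs.start_mem hv m hm)

/-- From a set of positions of Duplicator that are not winning, Duplicator has to leave within
finitely many moves, to a position from which Duplicator wins. -/
lemma DuplicatorWins.exists_leave (h : A.DuplicatorWins v) {U : Set V} (hv : v ∈ U)
    (howner : ∀ x ∈ U, A.owner x = .duplicator) (hU : ∀ x ∈ U, x ∉ A.winning) :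
    ∃ x ∈ U, ∃ m ∉ U, A.Move x m ∧ A.DuplicatorWins m := by
  obtain ⟨s, hs, hw⟩ := h
  by_contra! hcon
  have hnext (q : {q : List V × V // q.1 ++ [q.2] ∈ s ∧ q.2 ∈ U}) :
      ∃ m, q.1.1 ++ [q.1.2] ++ [m] ∈ s ∧ m ∈ U := by
    obtain ⟨m, ⟨hm, hms⟩, -⟩ := hs.duplicator_move _ _ q.2.1 (howner _ q.2.2)
    refine ⟨m, hms, ?_⟩
    by_contra hmU
    exact hcon _ q.2.2 m hmU hm (hs.duplicatorWins hw hms)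
  choose next hnext using hnext
  -- Strategies depend on the history, so it is carried along. If `U` is never left, this play never
  -- visits a winning position.
  let play : ℕ → {q : List V × V // q.1 ++ [q.2] ∈ s ∧ q.2 ∈ U} := fun n =>
    n.rec ⟨([], v), hs.start_mem, hv⟩ fun _ q => ⟨(q.1.1 ++ [q.1.2], next q), hnext q⟩
  have hplay (n : ℕ) : (List.range n).map (fun i => (play i).1.2) = (play n).1.1 := by
    induction n with
    | zero => rfl
    | succ n ih =>
      rw [List.range_succ, List.map_append, ih]
      rfl
  have hinf := hw.infinite_play (fun i => (play i).1.2) fun n => by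
    rw [List.range_succ, List.map_append, hplay]
    exact (play n).2.1
  obtain ⟨i, hi⟩ := hinf.nonempty
  exact hU _ (play i).2.2 hi

end BuchiArena

/-! ### The simulation extracted from the pointed game -/

section Pointed

variable {α : Type*}

open RegE

lemma SimPos.resolved_singleton {t : RegE α} {a : α} (ht : t.pol = .oracle a) :
    Resolved {t} := by
  intro u hu _
  rw [Finset.mem_singleton.1 hu]
  exact ⟨a, ht⟩

lemma SimPos.owner_of_oracle {t f : RegE α} {a : α} (ht : t.pol = .oracle a)
    (hf : f.InFragment) : owner ⟨Set.univ, {t}, f⟩ = .duplicator := by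
  have hone : RegE.one ≠ t := by
    rintro rfl
    simp [pol] at ht
  have hall := pol_ne_all hf
  simp only [owner, resolved_singleton ht, not_true_eq_false, if_false, Finset.mem_singleton, hone,
    and_false]
  cases h : f.pol <;> simp_all

lemma SimPos.owner_of_step {t t' f : RegE α} (ht : t.pol = .ex) (hs : RegE.Step t t') :
    owner ⟨Set.univ, {t}, f⟩ = .spoiler := by
  have hres : ¬ Resolved {t} := by
    intro hres
    obtain ⟨a, ha⟩ := hres t (Finset.mem_singleton_self t) (by rintro rfl; cases hs)
    simp [ht] at ha
  simp [owner, hres]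

lemma psimGame_move_of_oracle {t f : RegE α} {a : α} (ht : t.pol = .oracle a) {q : PSimPos α}
    (h : (psimGame α).Move ⟨{t}, f⟩ q) :
    ∃ f', RegE.Step f f' ∧ (q = ⟨{t}, f'⟩ ∨
      f.pol = .oracle a ∧ ∃ t', RegE.Step t t' ∧ q = ⟨{t'}, f'⟩) := by
  obtain ⟨k, hm⟩ := h
  obtain ⟨X, g⟩ := q
  generalize hP : PSimPos.toSimPos (⟨{t}, f⟩ : PSimPos α) = P at hm
  generalize hQ : PSimPos.toSimPos (⟨X, g⟩ : PSimPos α) = Q at hm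
  cases hm <;> simp only [PSimPos.toSimPos, SimPos.mk.injEq] at hP hQ <;>
    obtain ⟨-, rfl, rfl⟩ := hP <;> obtain ⟨-, rfl, rfl⟩ := hQ
  case explore hpol _ hu _ =>
    rw [Finset.mem_singleton.1 hu, ht] at hpol
    cases hpol
  case fork hpol hu _ =>
    rw [Finset.mem_singleton.1 hu, ht] at hpol
    cases hpol
  -- `f` is not assumed to be in the fragment, so alea remains possible; like choose and junk, it
  -- keeps `t`.
  case alea hs => exact ⟨_, hs, .inl rfl⟩
  case choose hs => exact ⟨_, hs, .inl rfl⟩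
  case junk hs => exact ⟨_, hs, .inl rfl⟩
  case fill u u' b hpolt hst hu hpole _ hX' hs =>
    obtain rfl := Finset.mem_singleton.1 hu
    rw [ht] at hpolt
    cases hpolt
    refine ⟨_, hs, .inr ⟨hpole, u', hst, ?_⟩⟩
    congr 1
    exact Finset.coe_injective (by simpa using hX')

/-- The positions with a single expression on the left from which Duplicator wins form a
simulation. -/
lemma isSimulation_duplicatorWins : IsSimulation fun t f : RegE α =>
    f.InFragment ∧ (psimGame α).DuplicatorWins ⟨{t}, f⟩ where
  explore := fun {t t' f} ⟨hf, h⟩ hpol hs =>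
    ⟨hf, h.of_spoiler_move (SimPos.owner_of_step hpol hs)
      ⟨_, .explore (Finset.mem_singleton_self t) hpol hs (by simp)⟩⟩
  fill := fun {t t' f a} ⟨hf, h⟩ hpol hs => by
    have howner (x) (hx : x ∈ {x : PSimPos α | ∃ g, ReflTransGen Step f g ∧ x = ⟨{t}, g⟩}) :
        (psimGame α).owner x = .duplicator := by
      obtain ⟨g, hfg, rfl⟩ := hx
      exact SimPos.owner_of_oracle hpol (inFragment_of_reflTransGen hfg hf)
    -- Every move that keeps `t` stays in this set, so the move leaving it is a fill.
    obtain ⟨_, ⟨g, hfg, rfl⟩, m, hm, hmove, hwin⟩ := h.exists_leave (U := {x : PSimPos α | ∃ g, ReflTransGen Step f g ∧ x = ⟨{t}, g⟩})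
      ⟨f, .refl, rfl⟩ howner fun x hx hwx => by
        have := (howner x hx).symm.trans hwx.1
        cases this
    obtain ⟨f', hgf', rfl | ⟨hpolg, u, hu, rfl⟩⟩ := psimGame_move_of_oracle hpol hmove
    · exact absurd ⟨f', hfg.tail hgf', rfl⟩ hm
    · obtain rfl := hs.unique_of_oracle hu hpol
      exact ⟨g, f', hfg, hpolg, hgf', inFragment_of_reflTransGen (hfg.tail hgf') hf, hwin⟩

end Pointed

end WeihrauchTheory

theorem mainTheorem4 {α : Type*} [Finite α] (e f : WeihrauchTheory.RegE α)
    (he : e.InFragment) (hf : f.InFragment)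
    (hwin : (WeihrauchTheory.psimGame α).DuplicatorWins ⟨{e}, f⟩) :
    WeihrauchTheory.RegE.DerivablePSRKA e f :=
  WeihrauchTheory.isSimulation_duplicatorWins.derivable he hf ⟨hf, hwin⟩
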